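/- Let $A=(a_{ij})$ be a real $4\times 4$ matrix. Its tropical tetrahedron $\operatorname{span}(A)\subset\mathbb{R}^3$ is the set of all points $(x_1-x_4,\,x_2-x_4,\,x_3-x_4)$ with $x_i=\max_{1\le j\le 4}(\lambda_j+a_{ij})$, $i=1,\dots,4$, where $\lambda_1,\dots,\lambda_4$ range over $\mathbb{R}$; that is, the max-plus span of the columns of $A$, viewed in the chart $X_4=0$ of the tropical projective space $\mathbb{R}^4/\mathbb{R}(1,1,1,1)\cong\mathbb{R}^3$. For a convex polytope in $\mathbb{R}^3$, the f-vector is the triple (number of vertices, number of edges, number of 2-dimensional facets), and the polygon-vector is $(f_3,f_4,f_5,f_6)$, where $f_m$ is the number of facets that are convex $m$-gons. Suppose that $\operatorname{span}(A)$ is convex. Then it is not possible that $\operatorname{span}(A)$ has f-vector $(20,30,12)$ and polygon-vector either $(0,0,12,0)$ or $(0,1,10,1)$. In particular, $\operatorname{span}(A)$ does not have the combinatorial type of the regular dodecahedron, i.e. the face lattices of $\operatorname{span}(A)$ and of the regular dodecahedron are not isomorphic. -/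

import Mathlib

/-- The tropical (max-plus) linear combination `(lam 1 + col 1) ⊕ ⋯ ⊕ (lam 4 + col 4)` of the
columns of `A`; it represents a point of tropical projective 3-space. -/
noncomputable def tropicalComb (A : Matrix (Fin 4) (Fin 4) ℝ) (lam : Fin 4 → ℝ) : Fin 4 → ℝ :=
  fun i => Finset.univ.sup' Finset.univ_nonempty (fun j => lam j + A i j)

/-- The identification of tropical projective 3-space `ℝ⁴ / ℝ(1,1,1,1)` with `ℝ³`: choose the
representative whose last coordinate is `0` and drop that coordinate. -/
def affineChart (x : Fin 4 → ℝ) : Fin 3 → ℝ :=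
  fun i => x i.castSucc - x (Fin.last 3)

/-- The tropical tetrahedron `span(A)`: the tropical span of the four columns of `A`, in `ℝ³`. -/
def tropicalSpan (A : Matrix (Fin 4) (Fin 4) ℝ) : Set (Fin 3 → ℝ) :=
  Set.range fun lam : Fin 4 → ℝ => affineChart (tropicalComb A lam)

/-- `F` is a nonempty (exposed) face of `P` of dimension `d`. -/
def IsFaceOfDim (P : Set (Fin 3 → ℝ)) (d : ℕ) (F : Set (Fin 3 → ℝ)) : Prop :=
  F.Nonempty ∧ IsExposed ℝ P F ∧ Module.finrank ℝ (vectorSpan ℝ F) = d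

/-- The f-vector of `P`: the numbers of vertices, edges and (2-dimensional) facets. -/
noncomputable def fVector (P : Set (Fin 3 → ℝ)) : ℕ × ℕ × ℕ :=
  ({F | IsFaceOfDim P 0 F}.ncard, {F | IsFaceOfDim P 1 F}.ncard, {F | IsFaceOfDim P 2 F}.ncard)

/-- The number of facets of `P` that are convex `m`-gons, i.e. have exactly `m` vertices. -/
noncomputable def polygonCount (P : Set (Fin 3 → ℝ)) (m : ℕ) : ℕ :=
  {F | IsFaceOfDim P 2 F ∧ (F.extremePoints ℝ).ncard = m}.ncard

/-- The polygon-vector `(f₃, f₄, f₅, f₆)` of `P`. -/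
noncomputable def polygonVector (P : Set (Fin 3 → ℝ)) : ℕ × ℕ × ℕ × ℕ :=
  (polygonCount P 3, polygonCount P 4, polygonCount P 5, polygonCount P 6)

/-- The face lattice of `P` (with the empty face and `P` itself), ordered by inclusion. -/
abbrev FaceLattice (P : Set (Fin 3 → ℝ)) : Type :=
  {F : Set (Fin 3 → ℝ) // IsExposed ℝ P F}

/-- `P` and `Q` have the same combinatorial type: their face lattices are isomorphic. -/
def SameCombinatorialType (P Q : Set (Fin 3 → ℝ)) : Prop :=
  Nonempty (FaceLattice P ≃o FaceLattice Q)

/-- The 20 vertices of the standard regular dodecahedron, with `φ` the golden ratio: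
`(±1, ±1, ±1)` and the cyclic permutations of `(0, ±1/φ, ±φ)`. -/
def dodecahedronVertices : Set (Fin 3 → ℝ) :=
  {x | (∀ i, |x i| = 1) ∨
    ∃ i, x i = 0 ∧ |x (i + 1)| = Real.goldenRatio⁻¹ ∧ |x (i + 2)| = Real.goldenRatio}

/-- The regular dodecahedron. -/
def regularDodecahedron : Set (Fin 3 → ℝ) :=
  convexHull ℝ dodecahedronVertices

/-!
A tropical tetrahedron that is convex is an alcoved polytope `{x | xᵢ - xⱼ ≤ C i j}`, with constants
that satisfy the triangle inequality (`exists_tropicalSpan_eq_alcoved`). Convexity is used in the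
chart `xᵢ = 0`, where every point of the tropical span lies above one of the finitely many columns.
The points close to `p` on the segment from a minimal column `p` to another column can only lie
above `p` itself, so every column lies above `p` (`exists_least_column`). The four least columns
thus obtained, one for each chart, describe the span by inequalities.

The two-dimensional faces of an alcoved polytope, and the coatoms of its face lattice, are among the
twelve sets `alcovedFacet C (i, j)` on which `xᵢ - xⱼ ≤ C i j` is tight. Let `{i, j, k, l}` be all
four indices. By the triangle inequality the facet `(i, j)` is a rectangle, given by the bounds for
`xₖ - xⱼ` and `xₗ - xⱼ`, from which `xₖ - xₗ ≤ C k l` and `xₗ - xₖ ≤ C l k` may cut off two opposite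
corners. The first corner survives if `C k j + C i l ≤ C i j + C k l`, the second one if
`C l j + C i k ≤ C i j + C l k`; if both do, the facet has at most four vertices
(`encard_extremePoints_alcovedFacet_le`).

These conditions only depend on the signs of six differences of the form
`C k j + C i l - C i j - C k l`, and the six differences, with suitable signs, add up to zero
(`sum_exchange`). They can be arranged in three pairs, in cyclic order, such that the facets
correspond to the arcs from a pair to the next one and a facet has at most four vertices if its arc
leads from a number `≤ 0` to a number `≥ 0`. There are always two such arcs (`exists_two_arcs`).

So at least two of the twelve facets have at most four vertices. Each of the two polygon-vectors
requires eleven facets with at least five vertices, and the face lattice of the dodecahedron has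
twelve coatoms with five atoms below each.
-/

/-! ### Faces of polyhedra -/

section Polyhedron

open Filter Topology

variable {R E : Type*} [NormedAddCommGroup E] [NormedSpace ℝ E]

/-- The polyhedron cut out by the inequalities `ℓ r x ≤ β r`. -/
def polyhedron (ℓ : R → E →L[ℝ] ℝ) (β : R → ℝ) : Set E :=
  {x | ∀ r, ℓ r x ≤ β r}

/-- The part of the polyhedron on which the inequality with index `r` is tight. It may be empty, or
the whole polyhedron, or a face of small dimension. -/
def tightFace (ℓ : R → E →L[ℝ] ℝ) (β : R → ℝ) (r : R) : Set E :=
  {x ∈ polyhedron ℓ β | ℓ r x = β r}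

variable {ℓ : R → E →L[ℝ] ℝ} {β : R → ℝ} {F : Set E} {x y z w : E}

theorem convex_polyhedron : Convex ℝ (polyhedron ℓ β) := by
  intro x hx y hy a b ha hb hab r
  have h1 := mul_le_mul_of_nonneg_left (hx r) ha
  have h2 := mul_le_mul_of_nonneg_left (hy r) hb
  have h3 : a * β r + b * β r = β r := by rw [← add_mul, hab, one_mul]
  simp only [map_add, map_smul, smul_eq_mul]
  linarith

theorem isClosed_polyhedron : IsClosed (polyhedron ℓ β) := by
  simp only [polyhedron, Set.ofPred_forall]
  exact isClosed_iInter fun r => isClosed_le (ℓ r).continuous continuous_const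

theorem isExposed_tightFace (r : R) : IsExposed ℝ (polyhedron ℓ β) (tightFace ℓ β r) := by
  rintro ⟨z, hz, hzr⟩
  refine ⟨ℓ r, Set.ext fun x => ⟨fun hx => ⟨hx.1, fun y hy => (hy r).trans hx.2.ge⟩, fun hx => ?_⟩⟩
  exact ⟨hx.1, le_antisymm (hx.1 r) (hzr ▸ hx.2 z hz)⟩

/-- A direction that violates no tight inequality can be followed for a short time. -/
theorem eventually_add_smul_mem_polyhedron [Finite R] (hz : z ∈ polyhedron ℓ β)
    (hw : ∀ r, ℓ r z = β r → ℓ r w ≤ 0) :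
    ∀ᶠ t : ℝ in 𝓝[>] 0, z + t • w ∈ polyhedron ℓ β := by
  refine eventually_all.2 fun r => ?_
  rcases (hz r).eq_or_lt with h | h
  · filter_upwards [self_mem_nhdsWithin] with t ht
    have := mul_nonpos_of_nonneg_of_nonpos (le_of_lt ht) (hw r h)
    simp only [map_add, map_smul, smul_eq_mul]
    linarith
  · have hc : Tendsto (fun t : ℝ => ℓ r (z + t • w)) (𝓝 0) (𝓝 (ℓ r z)) := by
      have : Continuous fun t : ℝ => ℓ r (z + t • w) := by fun_prop
      simpa using this.tendsto 0
    filter_upwards [(hc.mono_left nhdsWithin_le_nhds).eventually_lt_const h] with t ht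
    exact ht.le

/-- A convex subset of a polyhedron has a relative interior point, in the sense that only those
inequalities are tight at the point that are tight on the whole subset. -/
theorem exists_generic_point [Finite R] (hF : Convex ℝ F) (hne : F.Nonempty)
    (hFP : F ⊆ polyhedron ℓ β) :
    ∃ z ∈ F, ∀ r, ℓ r z = β r → ∀ x ∈ F, ℓ r x = β r := by
  classical
  cases nonempty_fintype R
  suffices h : ∀ S : Finset R, ∃ z ∈ F, ∀ r ∈ S, ℓ r z = β r → ∀ x ∈ F, ℓ r x = β r by
    simpa using h Finset.univ
  intro S
  induction S using Finset.induction_on with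
  | empty => exact ⟨hne.some, hne.some_mem, by simp⟩
  | insert r S _ ih =>
    obtain ⟨z, hz, hS⟩ := ih
    by_cases hr : ∀ x ∈ F, ℓ r x = β r
    · refine ⟨z, hz, fun r' hr' => ?_⟩
      rcases Finset.mem_insert.1 hr' with rfl | h
      exacts [fun _ => hr, hS r' h]
    · push Not at hr
      obtain ⟨x, hx, hxr⟩ := hr
      refine ⟨(1 / 2 : ℝ) • z + (1 / 2 : ℝ) • x,
        hF hz hx (by norm_num) (by norm_num) (by norm_num), fun r' hr' h => ?_⟩
      have h1 := hFP hz r'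
      have h2 := hFP hx r'
      simp only [map_add, map_smul, smul_eq_mul] at h
      rcases Finset.mem_insert.1 hr' with rfl | h'
      · exact absurd (by linarith) hxr
      · exact hS r' h' (by linarith)

/-- An exposed face contains every point of the polyhedron at which all inequalities are tight that
are tight at one given point of the face: the segment from the first point to the second can be
prolonged a little inside the polyhedron. -/
theorem IsExposed.mem_of_tight [Finite R] (hF : IsExposed ℝ (polyhedron ℓ β) F) (hz : z ∈ F)
    (hy : y ∈ polyhedron ℓ β) (h : ∀ r, ℓ r z = β r → ℓ r y = β r) : y ∈ F := by
  have hzP := hF.subset hz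
  obtain ⟨f, rfl⟩ := hF ⟨z, hz⟩
  have hw : ∀ r, ℓ r z = β r → ℓ r (z - y) ≤ 0 := fun r hr => by
    rw [map_sub, hr, h r hr, sub_self]
  obtain ⟨t, ht, ht0⟩ := ((eventually_add_smul_mem_polyhedron hzP hw).and
    self_mem_nhdsWithin).exists
  refine ⟨hy, fun x hx => (hz.2 x hx).trans ?_⟩
  have h1 := hz.2 _ ht
  simp only [map_add, map_smul, map_sub, smul_eq_mul] at h1
  have h2 : t * (f z - f y) ≤ t * 0 := by linarith
  linarith [le_of_mul_le_mul_left h2 ht0]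

theorem IsExposed.exists_subset_tightFace [Finite R] (hF : IsExposed ℝ (polyhedron ℓ β) F)
    (hne : F.Nonempty) (hFP : F ≠ polyhedron ℓ β) :
    ∃ r, F ⊆ tightFace ℓ β r ∧ tightFace ℓ β r ≠ polyhedron ℓ β := by
  obtain ⟨z, hz, hgen⟩ := exists_generic_point (hF.convex convex_polyhedron) hne hF.subset
  by_contra! H
  refine hFP (hF.subset.antisymm fun y hy => hF.mem_of_tight hz hy fun r hr => ?_)
  have := H r fun x hx => ⟨hF.subset hx, hgen r hr x hx⟩
  exact (this ▸ hy : y ∈ tightFace ℓ β r).2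

/-- Exposed faces of codimension one are of the form `tightFace ℓ β r`. -/
theorem IsExposed.exists_eq_tightFace [Finite R] [FiniteDimensional ℝ E] (hℓ : ∀ r, ℓ r ≠ 0)
    (hF : IsExposed ℝ (polyhedron ℓ β) F) (hne : F.Nonempty)
    (hd : Module.finrank ℝ (vectorSpan ℝ F) + 1 = Module.finrank ℝ E) :
    ∃ r, F = tightFace ℓ β r := by
  obtain ⟨z, hz, hgen⟩ := exists_generic_point (hF.convex convex_polyhedron) hne hF.subset
  obtain ⟨r, hr⟩ : ∃ r, ℓ r z = β r := by
    by_contra! H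
    -- otherwise the face contains a neighbourhood of `z`
    have htop : vectorSpan ℝ F = ⊤ := by
      refine eq_top_iff.2 fun w _ => ?_
      obtain ⟨t, ht, ht0⟩ := ((eventually_add_smul_mem_polyhedron (w := w) (hF.subset hz)
        fun r hr => absurd hr (H r)).and self_mem_nhdsWithin).exists
      have hm := vsub_mem_vectorSpan ℝ
        (hF.mem_of_tight hz ht fun r hr => absurd hr (H r)) hz
      rw [vsub_eq_sub, add_sub_cancel_left] at hm
      exact (Submodule.smul_mem_iff _ (ne_of_gt ht0)).1 hm
    rw [htop, finrank_top] at hd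
    omega
  have hsub : F ⊆ tightFace ℓ β r := fun x hx => ⟨hF.subset hx, hgen r hr x hx⟩
  refine ⟨r, hsub.antisymm fun y hy => ?_⟩
  have hle : vectorSpan ℝ F ≤ LinearMap.ker (ℓ r : E →ₗ[ℝ] ℝ) := by
    rw [vectorSpan_def, Submodule.span_le]
    rintro _ ⟨a, ha, b, hb, rfl⟩
    simp [(hsub ha).2, (hsub hb).2]
  have heq : vectorSpan ℝ F = LinearMap.ker (ℓ r : E →ₗ[ℝ] ℝ) := by
    refine Submodule.eq_of_le_of_finrank_eq hle ?_
    have h1 := Module.Dual.finrank_ker_add_one_of_ne_zero (f := (ℓ r : E →ₗ[ℝ] ℝ))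
      (fun h => hℓ r (ContinuousLinearMap.coe_injective h))
    omega
  have hyz : y - z ∈ vectorSpan ℝ F := by
    rw [heq, LinearMap.mem_ker]
    simp [hy.2, hr]
  obtain ⟨f, rfl⟩ := hF hne
  have hle' : vectorSpan ℝ {x ∈ polyhedron ℓ β | ∀ y ∈ polyhedron ℓ β, f y ≤ f x} ≤
      LinearMap.ker (f : E →ₗ[ℝ] ℝ) := by
    rw [vectorSpan_def, Submodule.span_le]
    rintro _ ⟨a, ha, b, hb, rfl⟩
    have := le_antisymm (ha.2 b hb.1) (hb.2 a ha.1)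
    simp [this]
  have hf : f y = f z := by
    have := hle' hyz
    simpa [sub_eq_zero] using this
  exact ⟨hy.1, fun x hx => hf ▸ hz.2 x hx⟩

/-- At an extreme point of a polyhedron the tight inequalities have full rank. -/
theorem exists_tight_of_mem_extremePoints [Finite R]
    (hx : x ∈ (polyhedron ℓ β).extremePoints ℝ) (hw : w ≠ 0) :
    ∃ r, ℓ r x = β r ∧ ℓ r w ≠ 0 := by
  by_contra! H
  rw [mem_extremePoints_iff_left] at hx
  obtain ⟨t, ⟨h1, h2⟩, ht⟩ := (((eventually_add_smul_mem_polyhedron (w := w) hx.1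
    fun r hr => (H r hr).le).and (eventually_add_smul_mem_polyhedron (w := -w) hx.1
    fun r hr => by simp [H r hr])).and self_mem_nhdsWithin).exists
  have h := hx.2 _ h1 _ h2 ⟨1 / 2, 1 / 2, by norm_num, by norm_num, by norm_num, by
    rw [smul_neg]; module⟩
  rw [add_eq_left, smul_eq_zero] at h
  exact h.elim (ne_of_gt ht) hw

/-- The minimal nonempty exposed faces of a compact polyhedron are its vertices. -/
theorem IsExposed.exists_eq_singleton_of_minimal [Finite R] (hc : IsCompact (polyhedron ℓ β))
    (hF : IsExposed ℝ (polyhedron ℓ β) F) (hne : F.Nonempty)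
    (hmin : ∀ G, IsExposed ℝ (polyhedron ℓ β) G → G ⊆ F → G.Nonempty → G = F) :
    ∃ v ∈ (polyhedron ℓ β).extremePoints ℝ, F = {v} := by
  obtain ⟨v, hv⟩ := (hF.isCompact hc).extremePoints_nonempty hne
  have hvF := extremePoints_subset hv
  refine ⟨v, hF.isExtreme.extremePoints_subset_extremePoints hv, ?_⟩
  refine Set.eq_singleton_iff_unique_mem.2 ⟨hvF, fun y hy => ?_⟩
  have htight : ∀ r, ℓ r v = β r → ∀ x ∈ F, ℓ r x = β r := fun r hr x hx => by
    have := hmin _ (hF.inter (isExposed_tightFace r)) Set.inter_subset_left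
      ⟨v, hvF, hF.subset hvF, hr⟩
    exact (this.ge hx).2.2
  -- otherwise the segment from `y` to `v` could be prolonged beyond `v` inside `F`
  obtain ⟨t, ht, ht0⟩ := ((eventually_add_smul_mem_polyhedron (w := v - y) (hF.subset hvF)
    fun r hr => by rw [map_sub, htight r hr y hy, hr, sub_self]).and self_mem_nhdsWithin).exists
  have hmem : v + t • (v - y) ∈ F := hF.mem_of_tight hvF ht fun r hr => by
    simp [hr, htight r hr y hy]
  have ht0 : 0 < t := ht0
  have ht1 : 0 < 1 + t := by linarith
  refine (mem_extremePoints_iff_left.1 hv).2 y hy _ hmem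
    ⟨t / (1 + t), 1 / (1 + t), div_pos ht0 ht1, by positivity, by field_simp; ring, ?_⟩
  have h1 : (1 / (1 + t)) * (1 + t) = 1 := by field_simp
  have h2 : t / (1 + t) - 1 / (1 + t) * t = 0 := by ring
  calc (t / (1 + t)) • y + (1 / (1 + t)) • (v + t • (v - y))
      = (t / (1 + t) - 1 / (1 + t) * t) • y + ((1 / (1 + t)) * (1 + t)) • v := by module
    _ = v := by rw [h1, h2]; simp

end Polyhedron

/-! ### Convex tropical tetrahedra are alcoved polytopes -/

section Alcoved

open Filter Topology

/-- The `i`-th homogeneous coordinate of a point of `ℝ³`, for the representative in `ℝ⁴` whose last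
coordinate is `0`. -/
noncomputable def homCoord (i : Fin 4) : (Fin 3 → ℝ) →L[ℝ] ℝ :=
  Fin.lastCases (motive := fun _ => (Fin 3 → ℝ) →L[ℝ] ℝ) 0 (fun k => ContinuousLinearMap.proj k) i

@[simp]
theorem homCoord_three : homCoord 3 = 0 :=
  Fin.lastCases_last (n := 3)

@[simp]
theorem homCoord_castSucc (k : Fin 3) (x : Fin 3 → ℝ) : homCoord k.castSucc x = x k := by
  simp [homCoord]

theorem homCoord_affineChart (y : Fin 4 → ℝ) (i : Fin 4) :
    homCoord i (affineChart y) = y i - y (Fin.last 3) := by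
  induction i using Fin.lastCases with
  | last => simp
  | cast k => rw [homCoord_castSucc, affineChart]

theorem affineChart_homCoord (x : Fin 3 → ℝ) : affineChart (fun i => homCoord i x) = x := by
  funext k
  simp [affineChart]

/-- The index set of the twelve inequalities of an alcoved polytope in `ℝ³`. -/
abbrev RootIndex : Type := {p : Fin 4 × Fin 4 // p.1 ≠ p.2}

/-- The difference of two homogeneous coordinates. -/
noncomputable def rootFunctional (r : RootIndex) : (Fin 3 → ℝ) →L[ℝ] ℝ :=
  homCoord r.1.1 - homCoord r.1.2

theorem rootFunctional_apply (r : RootIndex) (x : Fin 3 → ℝ) :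
    rootFunctional r x = homCoord r.1.1 x - homCoord r.1.2 x := rfl

/-- The alcoved polytope given by the inequalities `xᵢ - xⱼ ≤ C i j` for `i ≠ j` in homogeneous
coordinates. -/
abbrev alcoved (C : Fin 4 → Fin 4 → ℝ) : Set (Fin 3 → ℝ) :=
  polyhedron rootFunctional fun r : RootIndex => C r.1.1 r.1.2

/-- The set of points of `alcoved C` at which `xᵢ - xⱼ ≤ C i j` is an equality. It need not be
two-dimensional, and may coincide for different index pairs. -/
abbrev alcovedFacet (C : Fin 4 → Fin 4 → ℝ) (r : RootIndex) : Set (Fin 3 → ℝ) :=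
  tightFace rootFunctional (fun r : RootIndex => C r.1.1 r.1.2) r

theorem rootFunctional_ne_zero (r : RootIndex) : rootFunctional r ≠ 0 := by
  intro h
  have h1 := DFunLike.congr_fun h (affineChart (Pi.single r.1.1 1))
  rw [rootFunctional_apply, homCoord_affineChart, homCoord_affineChart] at h1
  simp [Pi.single_apply, r.2.symm] at h1

theorem isCompact_alcoved (C : Fin 4 → Fin 4 → ℝ) : IsCompact (alcoved C) := by
  refine IsCompact.of_isClosed_subset (isCompact_univ_pi fun k : Fin 3 =>
    isCompact_Icc (a := -C 3 k.castSucc) (b := C k.castSucc 3))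
    isClosed_polyhedron fun x hx k _ => ?_
  have hk : k.castSucc ≠ Fin.last 3 := (Fin.castSucc_lt_last k).ne
  have h1 := hx ⟨(k.castSucc, Fin.last 3), hk⟩
  have h2 := hx ⟨(Fin.last 3, k.castSucc), hk.symm⟩
  simp only [rootFunctional_apply, homCoord_castSucc, Fin.reduceLast, homCoord_three,
    zero_apply] at h1 h2
  constructor <;> linarith

theorem le_tropicalComb (A : Matrix (Fin 4) (Fin 4) ℝ) (lam : Fin 4 → ℝ) (i j : Fin 4) :
    lam j + A i j ≤ tropicalComb A lam i :=
  Finset.le_sup' (fun j => lam j + A i j) (Finset.mem_univ j)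

theorem exists_eq_tropicalComb (A : Matrix (Fin 4) (Fin 4) ℝ) (lam : Fin 4 → ℝ) (i : Fin 4) :
    ∃ j, tropicalComb A lam i = lam j + A i j := by
  obtain ⟨j, -, h⟩ := Finset.exists_mem_eq_sup' Finset.univ_nonempty (fun j => lam j + A i j)
  exact ⟨j, h⟩

/-- Residuation: a vector is a tropical combination of the columns of `A` if each of its coordinates
is attained by a translated column that stays below the vector. -/
theorem affineChart_mem_tropicalSpan (A : Matrix (Fin 4) (Fin 4) ℝ) (y : Fin 4 → ℝ)
    (h : ∀ i, ∃ j, ∀ k, A k j - A i j ≤ y k - y i) : affineChart y ∈ tropicalSpan A := by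
  -- the largest coefficients for which the combination stays below `y`
  refine ⟨fun j => Finset.univ.inf' Finset.univ_nonempty fun k => y k - A k j, ?_⟩
  refine congrArg affineChart (funext fun i => le_antisymm ?_ ?_)
  · refine Finset.sup'_le _ _ fun j _ => ?_
    have := Finset.inf'_le (fun k => y k - A k j) (Finset.mem_univ i)
    linarith
  · obtain ⟨j, hj⟩ := h i
    refine le_trans ?_ (le_tropicalComb A _ i j)
    have : y i - A i j ≤ Finset.univ.inf' Finset.univ_nonempty fun k => y k - A k j :=
      Finset.le_inf' _ _ fun k _ => by linarith [hj k]
    linarith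

theorem column_mem_tropicalSpan (A : Matrix (Fin 4) (Fin 4) ℝ) (j : Fin 4) :
    affineChart (fun k => A k j) ∈ tropicalSpan A :=
  affineChart_mem_tropicalSpan A _ fun _ => ⟨j, fun _ => le_rfl⟩

/-- In the chart `xᵢ = 0`, every point of the tropical span lies above some column. -/
theorem exists_column_le (A : Matrix (Fin 4) (Fin 4) ℝ) {x : Fin 3 → ℝ} (hx : x ∈ tropicalSpan A)
    (i : Fin 4) : ∃ j, ∀ k, A k j - A i j ≤ homCoord k x - homCoord i x := by
  obtain ⟨lam, rfl⟩ := hx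
  obtain ⟨j, hj⟩ := exists_eq_tropicalComb A lam i
  refine ⟨j, fun k => ?_⟩
  rw [homCoord_affineChart, homCoord_affineChart]
  linarith [le_tropicalComb A lam k j]

/-- If the tropical span is convex, then one of the columns is its least element in the chart
`xᵢ = 0`. Indeed, let `p` be a minimal column and `q` any other one. The points of the segment from
`p` to `q` lie above columns; for points close to `p` these columns lie below `p`, hence coincide
with it, so that the segment increases. -/
theorem exists_least_column (A : Matrix (Fin 4) (Fin 4) ℝ) (hA : Convex ℝ (tropicalSpan A))
    (i : Fin 4) : ∃ j₀, ∀ j k, A k j₀ - A i j₀ ≤ A k j - A i j := by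
  obtain ⟨_, ⟨p, rfl⟩, hmin⟩ := (Set.finite_range fun j k => A k j - A i j).exists_minimal
    (Set.range_nonempty _)
  refine ⟨p, fun q => ?_⟩
  by_contra! hq
  obtain ⟨k, hk⟩ := hq
  have hev : ∀ j, ∀ᶠ s : ℝ in 𝓝[>] 0, ¬ ∀ m,
      A m j - A i j ≤ (1 - s) * (A m p - A i p) + s * (A m q - A i q) := by
    intro j
    by_cases hj : ∀ m, A m j - A i j ≤ A m p - A i p
    · filter_upwards [self_mem_nhdsWithin] with s hs hle
      have h1 := hmin ⟨j, rfl⟩ hj k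
      have h2 := hle k
      have h3 := mul_lt_mul_of_pos_left hk (show (0 : ℝ) < s from hs)
      simp only at h1
      linarith
    · push Not at hj
      obtain ⟨m, hm⟩ := hj
      have hc : Tendsto (fun s : ℝ => (1 - s) * (A m p - A i p) + s * (A m q - A i q)) (𝓝 0)
          (𝓝 (A m p - A i p)) := by
        have : Continuous fun s : ℝ => (1 - s) * (A m p - A i p) + s * (A m q - A i q) := by
          fun_prop
        simpa using this.tendsto 0
      filter_upwards [(hc.mono_left nhdsWithin_le_nhds).eventually_lt_const hm] with s hs hle
      exact absurd (hle m) (not_le.2 hs)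
  obtain ⟨s, ⟨hs, hs1⟩, hs0⟩ := (((eventually_all.2 hev).and
    (nhdsWithin_le_nhds (Iio_mem_nhds one_pos))).and self_mem_nhdsWithin).exists
  have hs0 : 0 < s := hs0
  have hs1 : s < 1 := hs1
  have hmem := hA (column_mem_tropicalSpan A p) (column_mem_tropicalSpan A q)
    (sub_nonneg.2 hs1.le) hs0.le (by ring)
  obtain ⟨j, hj⟩ := exists_column_le A hmem i
  refine hs j fun m => (hj m).trans_eq ?_
  simp only [map_add, map_smul, smul_eq_mul, homCoord_affineChart]
  ring

/-- A convex tropical tetrahedron is an alcoved polytope, and the constants can be chosen to satisfy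
the triangle inequality. -/
theorem exists_tropicalSpan_eq_alcoved (A : Matrix (Fin 4) (Fin 4) ℝ)
    (hA : Convex ℝ (tropicalSpan A)) :
    ∃ C : Fin 4 → Fin 4 → ℝ, (∀ i j k, C i k ≤ C i j + C j k) ∧ tropicalSpan A = alcoved C := by
  choose c hc using exists_least_column A hA
  have hmem : ∀ x ∈ tropicalSpan A, ∀ i k,
      homCoord i x - homCoord k x ≤ A i (c i) - A k (c i) := by
    intro x hx i k
    obtain ⟨j, hj⟩ := exists_column_le A hx i
    linarith [hj k, hc i j k]
  refine ⟨fun i k => A i (c i) - A k (c i), fun i j k => ?_, ?_⟩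
  · have h := hmem _ (column_mem_tropicalSpan A (c j)) i k
    have h' := hmem _ (column_mem_tropicalSpan A (c i)) i j
    simp only [homCoord_affineChart] at h h'
    linarith [hc i (c j) k, hc i (c j) j, hc j (c i) k, hc j (c i) i]
  · refine Set.Subset.antisymm (fun x hx r => hmem x hx _ _) fun x hx => ?_
    rw [← affineChart_homCoord x]
    refine affineChart_mem_tropicalSpan A _ fun i => ⟨c i, fun k => ?_⟩
    rcases eq_or_ne i k with rfl | hik
    · simp
    · have := hx ⟨(i, k), hik⟩
      simp only [rootFunctional_apply] at this
      linarith

/-! ### Facets with at most four vertices -/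

/-- By `h₁`, the inequality `xₖ - xₗ ≤ C k l` cuts no corner off the rectangle that is described on
the hyperplane `xᵢ - xⱼ = C i j` by the bounds for `xₖ - xⱼ` and `xₗ - xⱼ`; by `h₂`, neither does
`xₗ - xₖ ≤ C l k`. Hence the facet is a (possibly degenerate) rectangle. -/
theorem encard_extremePoints_alcovedFacet_le {C : Fin 4 → Fin 4 → ℝ}
    (hC : ∀ i j k, C i k ≤ C i j + C j k) {i j k l : Fin 4} (hij : i ≠ j)
    (hik : i ≠ k) (hil : i ≠ l) (hjk : j ≠ k) (hjl : j ≠ l) (hkl : k ≠ l)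
    (h₁ : C k j + C i l ≤ C i j + C k l) (h₂ : C l j + C i k ≤ C i j + C l k) :
    ((alcovedFacet C ⟨(i, j), hij⟩).extremePoints ℝ).encard ≤ 4 := by
  have hmem : ∀ x ∈ alcoved C, ∀ a b, a ≠ b → homCoord a x - homCoord b x ≤ C a b :=
    fun x hx a b hab => hx ⟨(a, b), hab⟩
  have hall : ∀ m : Fin 4, m = i ∨ m = j ∨ m = k ∨ m = l := by
    revert hij hik hil hjk hjl hkl
    clear h₁ h₂
    revert i j k l
    decide
  -- moving a single coordinate shows that it is tied to another one
  have key : ∀ x ∈ (alcovedFacet C ⟨(i, j), hij⟩).extremePoints ℝ, ∀ a : Fin 4,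
      ∃ b, b ≠ a ∧ (homCoord a x - homCoord b x = C a b ∨ homCoord b x - homCoord a x = C b a) := by
    intro x hx a
    have hx' := (isExposed_tightFace _).isExtreme.extremePoints_subset_extremePoints hx
    have hne : affineChart (Pi.single a (1 : ℝ)) ≠ 0 := by
      intro h0
      obtain ⟨b, hb⟩ : ∃ b, b ≠ a := exists_ne a
      have h1 := homCoord_affineChart (Pi.single a (1 : ℝ)) a
      have h2 := homCoord_affineChart (Pi.single a (1 : ℝ)) b
      rw [h0, map_zero] at h1 h2
      simp only [Pi.single_eq_same, Pi.single_eq_of_ne hb] at h1 h2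
      linarith
    obtain ⟨⟨⟨b, b'⟩, hbb⟩, hr, hw⟩ := exists_tight_of_mem_extremePoints hx' hne
    simp only [rootFunctional_apply, homCoord_affineChart] at hr hw
    by_cases hba : b = a
    · subst hba
      exact ⟨b', fun h => hbb h.symm, Or.inl hr⟩
    · by_cases hba' : b' = a
      · subst hba'
        exact ⟨b, hba, Or.inr hr⟩
      · simp [hba, hba'] at hw
  have hfin :
      (({C k j, C i j - C i k} : Set ℝ) ×ˢ ({C l j, C i j - C i l} : Set ℝ)).encard ≤ 4 := by
    have hpair : ∀ a b : ℝ, ({a, b} : Set ℝ).ncard ≤ 2 := fun a b =>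
      (Set.ncard_insert_le a {b}).trans (by simp)
    refine Set.encard_le_coe_iff_finite_ncard_le.2 ⟨Set.toFinite _, ?_⟩
    rw [Set.ncard_prod]
    exact Nat.mul_le_mul (hpair _ _) (hpair _ _)
  refine le_trans (Set.encard_le_encard_of_injOn
    (f := fun x => (homCoord k x - homCoord j x, homCoord l x - homCoord j x)) ?_ ?_) hfin
  · intro x hx
    have hxF := extremePoints_subset hx
    have hF : homCoord i x - homCoord j x = C i j := hxF.2
    have hP := hmem x hxF.1
    have b1 := hP k j hjk.symm
    have b2 := hP i k hik
    have b3 := hP l j hjl.symm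
    have b4 := hP i l hil
    have b5 := hP k l hkl
    have b6 := hP l k hkl.symm
    have t1 := hC k i j
    have t2 := hC l i j
    have t3 := hC i j k
    have t4 := hC i j l
    simp only [Set.mem_prod, Set.mem_insert_iff, Set.mem_singleton_iff]
    constructor
    · obtain ⟨b, hb, hb'⟩ := key x hx k
      rcases hall b with rfl | rfl | rfl | rfl
      · rcases hb' with h | h
        · exact Or.inl (by linarith)
        · exact Or.inr (by linarith)
      · rcases hb' with h | h
        · exact Or.inl (by linarith)
        · exact Or.inr (by linarith)
      · exact absurd rfl hb
      · rcases hb' with h | h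
        · exact Or.inl (by linarith)
        · exact Or.inr (by linarith)
    · obtain ⟨b, hb, hb'⟩ := key x hx l
      rcases hall b with rfl | rfl | rfl | rfl
      · rcases hb' with h | h
        · exact Or.inl (by linarith)
        · exact Or.inr (by linarith)
      · rcases hb' with h | h
        · exact Or.inl (by linarith)
        · exact Or.inr (by linarith)
      · rcases hb' with h | h
        · exact Or.inl (by linarith)
        · exact Or.inr (by linarith)
      · exact absurd rfl hb
  · intro x hx y hy hxy
    have hFx : homCoord i x - homCoord j x = C i j := (extremePoints_subset hx).2
    have hFy : homCoord i y - homCoord j y = C i j := (extremePoints_subset hy).2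
    simp only [Prod.mk.injEq] at hxy
    have hd : ∀ m, homCoord m x - homCoord j x = homCoord m y - homCoord j y := by
      intro m
      rcases hall m with rfl | rfl | rfl | rfl
      exacts [hFx.trans hFy.symm, by rw [sub_self, sub_self], hxy.1, hxy.2]
    funext m
    have h1 := hd m.castSucc
    have h2 := hd (Fin.last 3)
    simp only [homCoord_castSucc, Fin.reduceLast, homCoord_three, zero_apply] at h1 h2
    linarith

/-- Let six real numbers with sum zero be placed on three pairs, arranged cyclically. Then at least
two of the twelve arcs from a pair to the next one start at a number `≤ 0` and end at a number
`≥ 0`. -/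
theorem exists_two_arcs (t : Fin 3 → Fin 2 → ℝ) (ht : ∑ m, ∑ a, t m a = 0) :
    ∃ e e' : Fin 3 × Fin 2 × Fin 2, e ≠ e' ∧ (t e.1 e.2.1 ≤ 0 ∧ 0 ≤ t (e.1 + 1) e.2.2) ∧
      (t e'.1 e'.2.1 ≤ 0 ∧ 0 ≤ t (e'.1 + 1) e'.2.2) := by
  have bool : ∀ b : Fin 3 → Fin 2 → Bool, (∃ m a, b m a = true) → (∃ m a, b m a = false) →
      ∃ e e' : Fin 3 × Fin 2 × Fin 2, e ≠ e' ∧ (b e.1 e.2.1 = true ∧ b (e.1 + 1) e.2.2 = false) ∧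
        (b e'.1 e'.2.1 = true ∧ b (e'.1 + 1) e'.2.2 = false) := by
    decide +kernel
  have hneg : ∃ m a, t m a ≤ 0 := by
    by_contra! h
    have : 0 < ∑ m, ∑ a, t m a :=
      Finset.sum_pos (fun m _ => Finset.sum_pos (fun a _ => h m a) Finset.univ_nonempty)
        Finset.univ_nonempty
    exact this.ne' ht
  by_cases hpos : ∃ m a, 0 < t m a
  · obtain ⟨e, e', hne, h, h'⟩ := bool (fun m a => decide (t m a ≤ 0)) (by simpa using hneg)
      (by simpa using hpos)
    simp only [decide_eq_true_eq, decide_eq_false_iff_not, not_le] at h h'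
    exact ⟨e, e', hne, ⟨h.1, h.2.le⟩, ⟨h'.1, h'.2.le⟩⟩
  · push Not at hpos
    -- all six numbers vanish, and any two arcs will do
    have h1 : ∀ m, ∑ a, t m a = 0 := fun m =>
      (Finset.sum_eq_zero_iff_of_nonpos fun m _ => Finset.sum_nonpos fun a _ => hpos m a).1 ht m
        (Finset.mem_univ m)
    have h2 : ∀ m a, t m a = 0 := fun m a =>
      (Finset.sum_eq_zero_iff_of_nonpos fun a _ => hpos m a).1 (h1 m) a (Finset.mem_univ a)
    exact ⟨(0, 0, 0), (1, 0, 0), by decide, by simp [h2], by simp [h2]⟩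

/-- The six exchange differences of `C`, one for each square of the cuboctahedron spanned by the
roots `eᵢ - eⱼ`, with signs that make their sum vanish. Two squares in the same row are opposite. -/
def exchange (C : Fin 4 → Fin 4 → ℝ) : Fin 3 → Fin 2 → ℝ :=
  ![![C 3 1 + C 0 2 - C 0 1 - C 3 2, C 2 0 + C 1 3 - C 1 0 - C 2 3],
    ![C 0 1 + C 2 3 - C 2 1 - C 0 3, C 1 0 + C 3 2 - C 3 0 - C 1 2],
    ![C 1 2 + C 0 3 - C 0 2 - C 1 3, C 3 0 + C 2 1 - C 2 0 - C 3 1]]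

/-- The entry for `(m, a, b)` is the root at which the square with index `(m, a)` meets the square
with index `(m + 1, b)`. -/
def exchangeRoot : Fin 3 × Fin 2 × Fin 2 → RootIndex := fun e =>
  ![![![⟨(0, 1), by decide⟩, ⟨(3, 2), by decide⟩], ![⟨(2, 3), by decide⟩, ⟨(1, 0), by decide⟩]],
    ![![⟨(0, 3), by decide⟩, ⟨(2, 1), by decide⟩], ![⟨(1, 2), by decide⟩, ⟨(3, 0), by decide⟩]],
    ![![⟨(0, 2), by decide⟩, ⟨(1, 3), by decide⟩], ![⟨(3, 1), by decide⟩, ⟨(2, 0), by decide⟩]]]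
    e.1 e.2.1 e.2.2

theorem exchangeRoot_injective : Function.Injective exchangeRoot := by
  decide +kernel

theorem sum_exchange (C : Fin 4 → Fin 4 → ℝ) : ∑ m, ∑ a, exchange C m a = 0 := by
  simp only [exchange, Fin.sum_univ_three, Fin.sum_univ_two, Matrix.cons_val]
  ring

theorem encard_extremePoints_exchangeRoot_le {C : Fin 4 → Fin 4 → ℝ}
    (hC : ∀ i j k, C i k ≤ C i j + C j k) (m : Fin 3) (a b : Fin 2)
    (h₁ : exchange C m a ≤ 0) (h₂ : 0 ≤ exchange C (m + 1) b) :
    ((alcovedFacet C (exchangeRoot (m, a, b))).extremePoints ℝ).encard ≤ 4 := by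
  have facet : ∀ i j k l : Fin 4, ∀ hij : i ≠ j,
      (i ≠ k ∧ i ≠ l ∧ j ≠ k ∧ j ≠ l ∧ k ≠ l) → C k j + C i l ≤ C i j + C k l →
      C l j + C i k ≤ C i j + C l k →
      ((alcovedFacet C ⟨(i, j), hij⟩).extremePoints ℝ).encard ≤ 4 :=
    fun i j k l hij h => encard_extremePoints_alcovedFacet_le hC hij h.1 h.2.1 h.2.2.1 h.2.2.2.1
      h.2.2.2.2
  fin_cases m <;> fin_cases a <;> fin_cases b <;>
    simp only [exchange, Fin.zero_eta, Fin.mk_one, Fin.reduceFinMk, Fin.reduceAdd, Matrix.cons_val,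
      Fin.isValue] at h₁ h₂
  · exact facet 0 1 2 3 _ (by decide) (by linarith) (by linarith)
  · exact facet 3 2 0 1 _ (by decide) (by linarith) (by linarith)
  · exact facet 2 3 0 1 _ (by decide) (by linarith) (by linarith)
  · exact facet 1 0 2 3 _ (by decide) (by linarith) (by linarith)
  · exact facet 0 3 1 2 _ (by decide) (by linarith) (by linarith)
  · exact facet 2 1 0 3 _ (by decide) (by linarith) (by linarith)
  · exact facet 1 2 0 3 _ (by decide) (by linarith) (by linarith)
  · exact facet 3 0 1 2 _ (by decide) (by linarith) (by linarith)
  · exact facet 0 2 1 3 _ (by decide) (by linarith) (by linarith)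
  · exact facet 1 3 0 2 _ (by decide) (by linarith) (by linarith)
  · exact facet 3 1 0 2 _ (by decide) (by linarith) (by linarith)
  · exact facet 2 0 1 3 _ (by decide) (by linarith) (by linarith)

theorem exists_two_facets_encard_le {C : Fin 4 → Fin 4 → ℝ}
    (hC : ∀ i j k, C i k ≤ C i j + C j k) :
    ∃ r r' : RootIndex, r ≠ r' ∧ ((alcovedFacet C r).extremePoints ℝ).encard ≤ 4 ∧
      ((alcovedFacet C r').extremePoints ℝ).encard ≤ 4 := by
  obtain ⟨e, e', hne, h, h'⟩ := exists_two_arcs (exchange C) (sum_exchange C)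
  exact ⟨exchangeRoot e, exchangeRoot e', exchangeRoot_injective.ne hne,
    encard_extremePoints_exchangeRoot_le hC _ _ _ h.1 h.2,
    encard_extremePoints_exchangeRoot_le hC _ _ _ h'.1 h'.2⟩

end Alcoved

/-! ### The face lattice -/

section FaceLattice

instance (P : Set (Fin 3 → ℝ)) : BoundedOrder (FaceLattice P) where
  top := ⟨P, IsExposed.refl P⟩
  le_top F := F.2.subset
  bot := ⟨∅, isExposed_empty⟩
  bot_le F := Set.empty_subset F.1

variable {P : Set (Fin 3 → ℝ)}

theorem FaceLattice.ne_bot_iff {F : FaceLattice P} : F ≠ ⊥ ↔ F.1.Nonempty := by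
  rw [Set.nonempty_iff_ne_empty]
  exact Subtype.ext_iff.not

theorem FaceLattice.ne_top_iff {F : FaceLattice P} : F ≠ ⊤ ↔ F.1 ≠ P :=
  Subtype.ext_iff.not

variable {C : Fin 4 → Fin 4 → ℝ}

theorem IsAtom.exists_eq_singleton {F : FaceLattice (alcoved C)} (hF : IsAtom F) :
    ∃ v ∈ (alcoved C).extremePoints ℝ, F.1 = {v} :=
  F.2.exists_eq_singleton_of_minimal (isCompact_alcoved C) (FaceLattice.ne_bot_iff.1 hF.1)
    fun G hG hGF hne => by
      rcases hF.le_iff.1 (show (⟨G, hG⟩ : FaceLattice (alcoved C)) ≤ F from hGF) with h | h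
      · exact absurd h (FaceLattice.ne_bot_iff.2 hne)
      · exact congrArg Subtype.val h

theorem IsCoatom.exists_eq_alcovedFacet {F : FaceLattice (alcoved C)} (hF : IsCoatom F)
    (hne : F ≠ ⊥) : ∃ r, F.1 = alcovedFacet C r := by
  obtain ⟨r, hr, hr'⟩ := F.2.exists_subset_tightFace (FaceLattice.ne_bot_iff.1 hne)
    (FaceLattice.ne_top_iff.1 hF.1)
  refine ⟨r, ?_⟩
  rcases hF.le_iff.1 (show F ≤ ⟨alcovedFacet C r, isExposed_tightFace r⟩ from hr) with h | h
  · exact absurd (congrArg Subtype.val h) hr'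
  · exact (congrArg Subtype.val h).symm

theorem card_rootIndex : Fintype.card RootIndex = 12 := by
  decide +kernel

/-- The face lattice of an alcoved polytope does not have twelve coatoms above each of which there
are five atoms. -/
theorem not_exists_twelve_coatoms (hC : ∀ i j k, C i k ≤ C i j + C j k) {ι : Type*} [Fintype ι]
    (hι : Fintype.card ι = 12) (f : ι → FaceLattice (alcoved C)) (hf : Function.Injective f)
    (hf' : ∀ i, IsCoatom (f i)) (g : ι → Fin 5 → FaceLattice (alcoved C))
    (hg : ∀ i, Function.Injective (g i)) (hg' : ∀ i a, IsAtom (g i a))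
    (hgf : ∀ i a, g i a ≤ f i) : False := by
  have hne : ∀ i, f i ≠ ⊥ := fun i h => (hg' i 0).1 (le_bot_iff.1 (h ▸ hgf i 0))
  choose ρ hρ using fun i => (hf' i).exists_eq_alcovedFacet (hne i)
  have hρinj : Function.Injective ρ := fun i j h =>
    hf (Subtype.ext (by rw [hρ, hρ, h]))
  have hρsurj : Function.Surjective ρ :=
    ((Fintype.bijective_iff_injective_and_card ρ).2 ⟨hρinj, hι.trans card_rootIndex.symm⟩).2
  obtain ⟨r, -, -, hr, -⟩ := exists_two_facets_encard_le hC
  obtain ⟨i, rfl⟩ := hρsurj r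
  choose v hv hgv using fun a => (hg' i a).exists_eq_singleton
  have hvinj : Function.Injective v := fun a b h => hg i (Subtype.ext (by rw [hgv, hgv, h]))
  have hvmem : Set.range v ⊆ (alcovedFacet C (ρ i)).extremePoints ℝ := by
    rintro _ ⟨a, rfl⟩
    refine inter_extremePoints_subset_extremePoints_of_subset (isExposed_tightFace _).subset
      ⟨?_, hv a⟩
    have : (g i a).1 ⊆ (f i).1 := hgf i a
    rw [hgv, hρ, Set.singleton_subset_iff] at this
    exact this
  have h5 := (Set.encard_le_encard hvmem).trans hr
  rw [← Set.image_univ, hvinj.encard_image, Set.encard_univ, ENat.card_eq_coe_fintype_card,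
    Fintype.card_fin] at h5
  exact absurd h5 (by decide)

/-- An alcoved polytope with twelve facets has at most ten facets with at least five vertices. -/
theorem polygonCount_five_add_six_le (hC : ∀ i j k, C i k ≤ C i j + C j k)
    (h12 : {F | IsFaceOfDim (alcoved C) 2 F}.ncard = 12) :
    polygonCount (alcoved C) 5 + polygonCount (alcoved C) 6 ≤ 10 := by
  have hsub : {F | IsFaceOfDim (alcoved C) 2 F} ⊆ Set.range (alcovedFacet C) := by
    rintro F ⟨hne, hF, hd⟩
    obtain ⟨r, hr⟩ := hF.exists_eq_tightFace rootFunctional_ne_zero hne (by simp [hd])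
    exact ⟨r, hr.symm⟩
  have hle : (Set.range (alcovedFacet C)).ncard ≤ 12 := by
    rw [← card_rootIndex, ← Nat.card_eq_fintype_card, ← Set.image_univ, ← Set.ncard_univ]
    exact Set.ncard_image_le
  have heq := Set.eq_of_subset_of_ncard_le hsub (by omega) (Set.finite_range _)
  have hinj : Function.Injective (alcovedFacet C) := by
    rw [← Set.injOn_univ]
    refine Set.injOn_of_ncard_image_eq ?_
    rw [Set.image_univ, ← heq, h12, Set.ncard_univ, Nat.card_eq_fintype_card, card_rootIndex]
  have hfin : {F | IsFaceOfDim (alcoved C) 2 F}.Finite := heq ▸ Set.finite_range _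
  obtain ⟨r, r', hne, hr, hr'⟩ := exists_two_facets_encard_le hC
  replace hr : _ ≤ 4 := (Set.encard_le_coe_iff_finite_ncard_le.1 hr).2
  replace hr' : _ ≤ 4 := (Set.encard_le_coe_iff_finite_ncard_le.1 hr').2
  have hmem : ∀ r, alcovedFacet C r ∈ {F | IsFaceOfDim (alcoved C) 2 F} := fun r =>
    heq ▸ Set.mem_range_self r
  have hpair : ({alcovedFacet C r, alcovedFacet C r'} : Set _) ⊆
      {F | IsFaceOfDim (alcoved C) 2 F} := by
    rintro _ (rfl | rfl)
    exacts [hmem r, hmem r']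
  have hdisj : Disjoint
      {F | IsFaceOfDim (alcoved C) 2 F ∧ (F.extremePoints ℝ).ncard = 5}
      {F | IsFaceOfDim (alcoved C) 2 F ∧ (F.extremePoints ℝ).ncard = 6} :=
    Set.disjoint_left.2 fun F h5 h6 => by
      have := h5.2.symm.trans h6.2
      omega
  have h10 := Set.ncard_sdiff hpair (Set.toFinite _)
  rw [h12, Set.ncard_pair (hinj.ne hne)] at h10
  rw [polygonCount, polygonCount, ← Set.ncard_union_eq hdisj
    (hfin.subset fun F h => h.1) (hfin.subset fun F h => h.1)]
  refine le_trans (Set.ncard_le_ncard ?_ (hfin.subset Set.sdiff_subset)) h10.le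
  rintro F (⟨hF, hF'⟩ | ⟨hF, hF'⟩)
  all_goals
    refine ⟨hF, ?_⟩
    rintro (rfl | rfl) <;> omega

end FaceLattice

/-! ### The regular dodecahedron -/

section Dodecahedron

open Real goldenRatio

/-- The vector with entries `a`, `b`, `c` at the positions `i`, `i + 1`, `i + 2` modulo `3`. -/
def rotVec (i : Fin 3) (a b c : ℝ) : Fin 3 → ℝ := fun j => ![a, b, c] (j - i)

section rotVec

variable (i : Fin 3) (a b c : ℝ)

@[simp]
theorem rotVec_apply_self : rotVec i a b c i = a := by
  simp [rotVec]

@[simp]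
theorem rotVec_apply_add_one : rotVec i a b c (i + 1) = b := by
  simp [rotVec]

@[simp]
theorem rotVec_apply_add_two : rotVec i a b c (i + 2) = c := by
  simp [rotVec]

theorem map_rotVec (g : (Fin 3 → ℝ) →L[ℝ] ℝ) :
    g (rotVec i a b c) =
      a * g (Pi.single i 1) + b * g (Pi.single (i + 1) 1) + c * g (Pi.single (i + 2) 1) := by
  have : rotVec i a b c =
      a • Pi.single i 1 + b • Pi.single (i + 1) 1 + c • Pi.single (i + 2) (1 : ℝ) := by
    funext j
    fin_cases i <;> fin_cases j <;> simp [rotVec]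
  rw [this]
  simp

theorem eq_rotVec (x : Fin 3 → ℝ) : x = rotVec i (x i) (x (i + 1)) (x (i + 2)) := by
  funext j
  fin_cases i <;> fin_cases j <;> simp [rotVec]

end rotVec

theorem rotVec_mem_of_abs_eq_one (i : Fin 3) {a b c : ℝ} (ha : |a| = 1) (hb : |b| = 1)
    (hc : |c| = 1) : rotVec i a b c ∈ dodecahedronVertices := by
  left
  intro j
  unfold rotVec
  generalize j - i = k
  fin_cases k <;> simpa

theorem rotVec_zero_mem (i : Fin 3) {b c : ℝ} (hb : |b| = φ⁻¹) (hc : |c| = φ) :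
    rotVec i 0 b c ∈ dodecahedronVertices :=
  Or.inr ⟨i, by simp, by simpa using hb, by simpa using hc⟩

theorem sum_sq_of_mem_dodecahedronVertices {v : Fin 3 → ℝ} (hv : v ∈ dodecahedronVertices) :
    ∑ j, v j ^ 2 = 3 := by
  rcases hv with hv | ⟨i, h0, h1, h2⟩
  · have : ∀ j, v j ^ 2 = 1 := fun j => by rw [← sq_abs, hv j, one_pow]
    simp [this]
  · have hsum : ∑ j, v j ^ 2 = v i ^ 2 + v (i + 1) ^ 2 + v (i + 2) ^ 2 := by
      fin_cases i <;> simp [Fin.sum_univ_three] <;> ring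
    rw [hsum, h0, ← sq_abs (v (i + 1)), h1, ← sq_abs (v (i + 2)), h2, inv_goldenRatio, neg_sq,
      goldenRatio_sq, goldenConj_sq]
    linarith [goldenRatio_add_goldenConj]

theorem sum_sq_le_of_mem_regularDodecahedron {x : Fin 3 → ℝ} (hx : x ∈ regularDodecahedron) :
    ∑ j, x j ^ 2 ≤ 3 := by
  have hconv : Convex ℝ {x : Fin 3 → ℝ | ∑ j, x j ^ 2 ≤ 3} := by
    intro x hx y hy a b ha hb hab
    simp only [Set.mem_ofPred_eq] at hx hy ⊢
    have h : ∑ j, (a • x + b • y) j ^ 2 ≤ ∑ j, (a * x j ^ 2 + b * y j ^ 2) := by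
      refine Finset.sum_le_sum fun j _ => ?_
      simp only [Pi.add_apply, Pi.smul_apply, smul_eq_mul]
      obtain rfl : b = 1 - a := by linarith
      nlinarith [mul_nonneg (mul_nonneg ha hb) (sq_nonneg (x j - y j))]
    rw [Finset.sum_add_distrib, ← Finset.mul_sum, ← Finset.mul_sum] at h
    have h1 := mul_le_mul_of_nonneg_left hx ha
    have h2 := mul_le_mul_of_nonneg_left hy hb
    have h3 : a * 3 + b * 3 = 3 := by rw [← add_mul, hab, one_mul]
    linarith
  exact convexHull_min (fun v hv => (sum_sq_of_mem_dodecahedronVertices hv).le) hconv hx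

/-- Each of the twenty vertices is exposed, because they all lie on a sphere. -/
theorem isExposed_singleton_of_mem_dodecahedronVertices {v : Fin 3 → ℝ}
    (hv : v ∈ dodecahedronVertices) : IsExposed ℝ regularDodecahedron {v} := by
  rw [← mem_exposedPoints_iff_exposed_singleton]
  refine ⟨subset_convexHull _ _ hv, ∑ j, v j • ContinuousLinearMap.proj j, fun y hy => ?_⟩
  have h1 := sum_sq_le_of_mem_regularDodecahedron hy
  have h2 := sum_sq_of_mem_dodecahedronVertices hv
  have h3 : ∑ j, (y j - v j) ^ 2 = ∑ j, y j ^ 2 + ∑ j, v j ^ 2 - 2 * ∑ j, v j * y j := by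
    simp only [Fin.sum_univ_three]
    ring
  have h4 : ∑ j, v j * v j = 3 := by simpa [sq] using h2
  have h5 : 0 ≤ ∑ j, (y j - v j) ^ 2 := Finset.sum_nonneg fun j _ => sq_nonneg _
  simp only [sum_apply, smul_apply,
    ContinuousLinearMap.proj_apply, smul_eq_mul, h4]
  refine ⟨by linarith, fun h => ?_⟩
  have h6 : ∑ j, (y j - v j) ^ 2 = 0 := by linarith
  rw [Finset.sum_eq_zero_iff_of_nonneg fun j _ => sq_nonneg _] at h6
  funext j
  exact sub_eq_zero.1 (pow_eq_zero_iff two_ne_zero |>.1 (h6 j (Finset.mem_univ j)))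

/-- An outer normal of a facet of the dodecahedron; the signs `s`, `t` are `±1`. -/
noncomputable def dodecahedronNormal (i : Fin 3) (s t : ℝ) : (Fin 3 → ℝ) →L[ℝ] ℝ :=
  s • ContinuousLinearMap.proj i + (t * φ) • ContinuousLinearMap.proj (i + 2)

theorem dodecahedronNormal_apply (i : Fin 3) (s t : ℝ) (x : Fin 3 → ℝ) :
    dodecahedronNormal i s t x = s * x i + t * φ * x (i + 2) := by
  simp [dodecahedronNormal]

/-- The five vertices of a facet of the dodecahedron, sorted by their coordinate with index
`i + 1`. -/
noncomputable def dodecahedronFacetVertex (i : Fin 3) (s t : ℝ) : Fin 5 → Fin 3 → ℝ :=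
  ![rotVec i s (-1) t, rotVec i 0 (-φ⁻¹) (t * φ), rotVec i (s * φ) 0 (t * φ⁻¹),
    rotVec i 0 φ⁻¹ (t * φ), rotVec i s 1 t]

variable {i : Fin 3} {s t : ℝ}

theorem dodecahedronFacetVertex_injective (i : Fin 3) (s t : ℝ) :
    Function.Injective (dodecahedronFacetVertex i s t) := by
  have hmono : StrictMono ![-1, -φ⁻¹, 0, φ⁻¹, 1] := by
    have h0 : 0 < φ⁻¹ := inv_pos.2 goldenRatio_pos
    have h1 : φ⁻¹ < 1 := inv_lt_one_of_one_lt₀ one_lt_goldenRatio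
    refine Fin.strictMono_iff_lt_succ.2 fun a => ?_
    fin_cases a
    exacts [neg_lt_neg h1, neg_lt_zero.2 h0, h0, h1]
  have hcoord : ∀ a, dodecahedronFacetVertex i s t a (i + 1) = ![-1, -φ⁻¹, 0, φ⁻¹, 1] a := by
    intro a
    fin_cases a <;> exact rotVec_apply_add_one _ _ _ _
  intro a b h
  exact hmono.injective (by rw [← hcoord, h, hcoord])

theorem dodecahedronFacetVertex_mem (hs : |s| = 1) (ht : |t| = 1) (a : Fin 5) :
    dodecahedronFacetVertex i s t a ∈ dodecahedronVertices := by
  have hφ := goldenRatio_pos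
  have h1 : |t * φ| = φ := by rw [abs_mul, ht, one_mul, abs_of_pos hφ]
  have h2 : |φ⁻¹| = φ⁻¹ := abs_of_pos (inv_pos.2 hφ)
  fin_cases a
  · exact rotVec_mem_of_abs_eq_one i hs (by simp) ht
  · exact rotVec_zero_mem i (by rw [abs_neg, h2]) h1
  · refine Or.inr ⟨i + 1, ?_, ?_, ?_⟩
    · exact rotVec_apply_add_one _ _ _ _
    · rw [show i + 1 + 1 = i + 2 by rw [add_assoc]; rfl]
      refine (congrArg abs (rotVec_apply_add_two _ _ _ _)).trans ?_
      rw [abs_mul, ht, one_mul, h2]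
    · rw [show i + 1 + 2 = i by rw [add_assoc]; exact add_zero i]
      refine (congrArg abs (rotVec_apply_self _ _ _ _)).trans ?_
      rw [abs_mul, hs, one_mul, abs_of_pos hφ]
  · exact rotVec_zero_mem i h2 h1
  · exact rotVec_mem_of_abs_eq_one i hs (by simp) ht

theorem dodecahedronNormal_facetVertex (hs : |s| = 1) (ht : |t| = 1) (a : Fin 5) :
    dodecahedronNormal i s t (dodecahedronFacetVertex i s t a) = φ + 1 := by
  have hs2 : s * s = 1 := by rw [← abs_mul_abs_self, hs, one_mul]
  have ht2 : t * t = 1 := by rw [← abs_mul_abs_self, ht, one_mul]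
  have hφ := goldenRatio_sq
  have hφ' : φ * φ⁻¹ = 1 := mul_inv_cancel₀ goldenRatio_ne_zero
  have key : ∀ a b c : ℝ, s * a + t * φ * c = φ + 1 →
      dodecahedronNormal i s t (rotVec i a b c) = φ + 1 := fun a b c h => by
    rwa [dodecahedronNormal_apply, rotVec_apply_self, rotVec_apply_add_two]
  fin_cases a <;> refine key _ _ _ ?_
  · linear_combination hs2 + φ * ht2
  · linear_combination hφ + φ ^ 2 * ht2
  · linear_combination φ * hs2 + φ * φ⁻¹ * ht2 + hφ'
  · linear_combination hφ + φ ^ 2 * ht2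
  · linear_combination hs2 + φ * ht2

theorem dodecahedronNormal_le (hs : |s| = 1) (ht : |t| = 1) {x : Fin 3 → ℝ}
    (hx : x ∈ regularDodecahedron) : dodecahedronNormal i s t x ≤ φ + 1 := by
  refine convexHull_min (fun v hv => ?_)
    (convex_halfSpace_le (dodecahedronNormal i s t).toLinearMap.isLinear (φ + 1)) hx
  have hφ0 := goldenRatio_pos
  have hφ1 := one_lt_goldenRatio
  have hφ := goldenRatio_sq
  have hinv : φ⁻¹ = φ - 1 := by
    rw [inv_goldenRatio]
    linarith [goldenRatio_add_goldenConj]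
  have key : ∀ {a c : ℝ}, |v i| = a → |v (i + 2)| = c → a + φ * c ≤ φ + 1 →
      dodecahedronNormal i s t v ≤ φ + 1 := by
    intro a c ha hc hac
    refine le_trans (le_abs_self _) (le_trans ?_ hac)
    rw [dodecahedronNormal_apply]
    refine (abs_add_le _ _).trans_eq ?_
    rw [abs_mul, abs_mul, abs_mul, hs, ht, ha, hc, abs_of_pos hφ0, one_mul, one_mul]
  rcases hv with hv | ⟨m, h0, h1, h2⟩
  · exact key (hv _) (hv _) (by linarith)
  · obtain rfl | rfl | rfl : m = i ∨ m = i + 1 ∨ m = i + 2 := by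
      clear key h0 h1 h2
      revert m i
      decide
    · exact key (by rw [h0, abs_zero]) h2 (by nlinarith)
    · rw [show i + 1 + 1 = i + 2 by rw [add_assoc]; rfl] at h1
      rw [show i + 1 + 2 = i by rw [add_assoc]; exact add_zero i] at h2
      exact key h2 h1 (by rw [hinv]; nlinarith)
    · rw [show i + 2 + 1 = i by rw [add_assoc]; exact add_zero i] at h1
      exact key h1 (by rw [h0, abs_zero]) (by rw [hinv]; linarith)

/-- A functional that is constant on the vertices of a facet is a multiple of the normal. -/
theorem exists_eq_smul_dodecahedronNormal (hs : |s| = 1) (ht : |t| = 1)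
    (g : (Fin 3 → ℝ) →L[ℝ] ℝ) {M : ℝ} (hg : ∀ a, g (dodecahedronFacetVertex i s t a) = M) :
    ∃ κ : ℝ, g = κ • dodecahedronNormal i s t := by
  have hs2 : s * s = 1 := by rw [← abs_mul_abs_self, hs, one_mul]
  have ht2 : t * t = 1 := by rw [← abs_mul_abs_self, ht, one_mul]
  have hφ := goldenRatio_sq
  have h0 : g (rotVec i s (-1) t) = M := hg 0
  have h3 : g (rotVec i 0 φ⁻¹ (t * φ)) = M := hg 3
  have h4 : g (rotVec i s 1 t) = M := hg 4
  rw [map_rotVec] at h0 h3 h4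
  have hb : g (Pi.single (i + 1) 1) = 0 := by linarith
  rw [hb] at h3 h4
  have hc : s * g (Pi.single i 1) = t * (φ - 1) * g (Pi.single (i + 2) 1) := by
    linear_combination h4 - h3
  refine ⟨s * g (Pi.single i 1), ContinuousLinearMap.ext fun x => ?_⟩
  conv_lhs => rw [eq_rotVec i x, map_rotVec, hb]
  rw [smul_apply, dodecahedronNormal_apply, smul_eq_mul]
  linear_combination (-(x i) * g (Pi.single i 1)) * hs2 - t * φ * x (i + 2) * hc -
    x (i + 2) * g (Pi.single (i + 2) 1) * (φ ^ 2 - φ) * ht2 -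
    x (i + 2) * g (Pi.single (i + 2) 1) * hφ

/-- The facet of the dodecahedron with a given outer normal. -/
noncomputable def dodecahedronFacet (i : Fin 3) (s t : ℝ) : FaceLattice regularDodecahedron :=
  ⟨(dodecahedronNormal i s t).toExposed regularDodecahedron,
    ContinuousLinearMap.toExposed.isExposed⟩

theorem dodecahedronFacetVertex_mem_facet (hs : |s| = 1) (ht : |t| = 1) (a : Fin 5) :
    dodecahedronFacetVertex i s t a ∈ (dodecahedronFacet i s t).1 :=
  ⟨subset_convexHull _ _ (dodecahedronFacetVertex_mem hs ht a), fun y hy => by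
    rw [dodecahedronNormal_facetVertex hs ht]
    exact dodecahedronNormal_le hs ht hy⟩

theorem isCoatom_dodecahedronFacet (hs : |s| = 1) (ht : |t| = 1) :
    IsCoatom (dodecahedronFacet i s t) := by
  have hφ := goldenRatio_pos
  have hs2 : s * s = 1 := by rw [← abs_mul_abs_self, hs, one_mul]
  have ht2 : t * t = 1 := by rw [← abs_mul_abs_self, ht, one_mul]
  -- the antipode of a vertex of the facet
  have hopp : rotVec i (-s) (-1) (-t) ∈ regularDodecahedron :=
    subset_convexHull _ _ (rotVec_mem_of_abs_eq_one i (by simpa) (by simp) (by simpa))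
  have hval : dodecahedronNormal i s t (rotVec i (-s) (-1) (-t)) = -(φ + 1) := by
    rw [dodecahedronNormal_apply, rotVec_apply_self, rotVec_apply_add_two]
    linear_combination -hs2 - φ * ht2
  have hvert := dodecahedronFacetVertex_mem_facet (i := i) hs ht
  constructor
  · rw [FaceLattice.ne_top_iff]
    intro h
    have hmem : rotVec i (-s) (-1) (-t) ∈ (dodecahedronFacet i s t).1 := h.symm ▸ hopp
    have h1 := hmem.2 _ (hvert 0).1
    rw [dodecahedronNormal_facetVertex hs ht, hval] at h1
    linarith
  · rintro ⟨G, hG⟩ hlt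
    have hsub : (dodecahedronFacet i s t).1 ⊆ G := hlt.le
    obtain ⟨g, rfl⟩ := hG ⟨_, hsub (hvert 0)⟩
    obtain ⟨κ, rfl⟩ := exists_eq_smul_dodecahedronNormal (i := i) hs ht g
      (M := g (dodecahedronFacetVertex i s t 0)) fun a =>
        le_antisymm ((hsub (hvert 0)).2 _ (hvert a).1) ((hsub (hvert a)).2 _ (hvert 0).1)
    have hκ := (hsub (hvert 0)).2 _ hopp
    simp only [smul_apply, smul_eq_mul, hval,
      dodecahedronNormal_facetVertex hs ht] at hκ
    have hκ0 : 0 ≤ κ := by nlinarith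
    rcases hκ0.eq_or_lt with rfl | hpos
    · refine Subtype.ext (Set.Subset.antisymm (fun x hx => hx.1) fun x hx => ⟨hx, fun y _ => ?_⟩)
      simp
    · refine absurd (Subtype.ext (hsub.antisymm fun x hx => ⟨hx.1, fun y hy => ?_⟩)) hlt.ne
      have := hx.2 y hy
      simp only [smul_apply, smul_eq_mul] at this
      exact le_of_mul_le_mul_left this hpos

theorem dodecahedronFacet_injective {i' : Fin 3} {s' t' : ℝ} (hs : |s| = 1) (ht : |t| = 1)
    (hs' : |s'| = 1) (ht' : |t'| = 1)
    (h : dodecahedronFacet i s t = dodecahedronFacet i' s' t') : i = i' ∧ s = s' ∧ t = t' := by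
  have hφ := goldenRatio_pos
  have hval : ∀ a, dodecahedronNormal i' s' t' (dodecahedronFacetVertex i s t a) = φ + 1 := by
    intro a
    have hmem : dodecahedronFacetVertex i s t a ∈ (dodecahedronFacet i' s' t').1 :=
      h ▸ dodecahedronFacetVertex_mem_facet hs ht a
    refine le_antisymm (dodecahedronNormal_le hs' ht' hmem.1) ?_
    have := hmem.2 _ (dodecahedronFacetVertex_mem_facet (i := i') hs' ht' 0).1
    rwa [dodecahedronNormal_facetVertex hs' ht'] at this
  obtain ⟨κ, hκ⟩ := exists_eq_smul_dodecahedronNormal hs ht _ hval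
  have hκ1 : κ = 1 := by
    have := hval 0
    rw [hκ, smul_apply, dodecahedronNormal_facetVertex hs ht, smul_eq_mul]
      at this
    exact mul_right_cancel₀ (by linarith : φ + 1 ≠ 0) (this.trans (one_mul _).symm)
  rw [hκ1, one_smul] at hκ
  have hx := fun x => DFunLike.congr_fun hκ x
  simp only [dodecahedronNormal_apply] at hx
  have hs0 : s' ≠ 0 := by rintro rfl; simp at hs'
  have ht0 : t' ≠ 0 := by rintro rfl; simp at ht'
  have hii : i = i' := by
    -- the normal vanishes on exactly one of the coordinate axes
    have h1 := hx (Pi.single (i + 1) 1)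
    obtain rfl | rfl | rfl : i' = i ∨ i' = i + 1 ∨ i' = i + 2 := by
      clear hκ hx hval h h1
      revert i i'
      decide
    · rfl
    · simp [hs0] at h1
    · rw [show i + 2 + 2 = i + 1 by rw [add_assoc]; rfl] at h1
      simp [ht0, hφ.ne'] at h1
  subst hii
  have h1 := hx (Pi.single i 1)
  have h2 := hx (Pi.single (i + 2) 1)
  rw [Pi.single_eq_same, Pi.single_eq_of_ne (by simp)] at h1 h2
  refine ⟨rfl, by linarith, mul_right_cancel₀ hφ.ne' (by linarith)⟩

/-- A vertex of a facet of the dodecahedron as an element of the face lattice. -/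
noncomputable def dodecahedronVertexFace (i : Fin 3) (hs : |s| = 1) (ht : |t| = 1) (a : Fin 5) :
    FaceLattice regularDodecahedron :=
  ⟨{dodecahedronFacetVertex i s t a}, isExposed_singleton_of_mem_dodecahedronVertices
    (dodecahedronFacetVertex_mem hs ht a)⟩

theorem isAtom_dodecahedronVertexFace (hs : |s| = 1) (ht : |t| = 1) (a : Fin 5) :
    IsAtom (dodecahedronVertexFace i hs ht a) := by
  refine ⟨FaceLattice.ne_bot_iff.2 (Set.singleton_nonempty _), fun G hG => ?_⟩
  by_contra hne
  refine hG.ne (Subtype.ext ?_)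
  exact (Set.Nonempty.subset_singleton_iff (FaceLattice.ne_bot_iff.1 hne)).1 hG.le

theorem abs_intUnit (u : ℤˣ) : |((u : ℤ) : ℝ)| = 1 := by
  rcases Int.units_eq_one_or u with rfl | rfl <;> simp

end Dodecahedron

theorem mainTheorem2 (A : Matrix (Fin 4) (Fin 4) ℝ) (hA : Convex ℝ (tropicalSpan A)) :
    ¬ (fVector (tropicalSpan A) = (20, 30, 12) ∧
        (polygonVector (tropicalSpan A) = (0, 0, 12, 0) ∨
          polygonVector (tropicalSpan A) = (0, 1, 10, 1))) ∧
      ¬ SameCombinatorialType (tropicalSpan A) regularDodecahedron := by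
  obtain ⟨C, hC, hAC⟩ := exists_tropicalSpan_eq_alcoved A hA
  rw [hAC]
  constructor
  · rintro ⟨hf, hp⟩
    simp only [fVector, polygonVector, Prod.mk.injEq] at hf hp
    have := polygonCount_five_add_six_le hC hf.2.2
    omega
  · rintro ⟨e⟩
    have hinj : Function.Injective fun d : Fin 3 × ℤˣ × ℤˣ =>
        dodecahedronFacet d.1 ((d.2.1 : ℤ) : ℝ) ((d.2.2 : ℤ) : ℝ) := by
      rintro ⟨i, s, t⟩ ⟨i', s', t'⟩ h
      obtain ⟨rfl, h1, h2⟩ := dodecahedronFacet_injective (abs_intUnit s) (abs_intUnit t)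
        (abs_intUnit s') (abs_intUnit t') h
      rw [Units.ext (Int.cast_injective h1), Units.ext (Int.cast_injective h2)]
    refine not_exists_twelve_coatoms hC (ι := Fin 3 × ℤˣ × ℤˣ) (by decide)
      (fun d => e.symm (dodecahedronFacet d.1 ((d.2.1 : ℤ) : ℝ) ((d.2.2 : ℤ) : ℝ)))
      (e.symm.injective.comp hinj)
      (fun d => (e.symm.isCoatom_iff _).2
        (isCoatom_dodecahedronFacet (abs_intUnit _) (abs_intUnit _)))
      (fun d a => e.symm (dodecahedronVertexFace d.1 (abs_intUnit d.2.1) (abs_intUnit d.2.2) a))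
      (fun d => e.symm.injective.comp fun a b h => dodecahedronFacetVertex_injective _ _ _
        (Set.singleton_injective (congrArg Subtype.val h)))
      (fun d a => (e.symm.isAtom_iff _).2 (isAtom_dodecahedronVertexFace _ _ a))
      (fun d a => e.symm.monotone (Set.singleton_subset_iff.2
        (dodecahedronFacetVertex_mem_facet (abs_intUnit _) (abs_intUnit _) a)))
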